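/- Let $k$ and $n$ be positive integers with $k\le n$. Let $\mathbb{C}[S_k]$ be the group algebra of the symmetric group, i.e. the space of all functions $S_k\to\mathbb{C}$ with the convolution product \[(f_1*f_2)(\pi)=\sum_{\sigma\in S_k} f_1(\sigma)\,f_2(\sigma^{-1}\pi),\] and let $\delta_{e}$ be the function equal to $1$ at the identity permutation and $0$ elsewhere. Write $\mathrm{fix}(\sigma)$ for the number of fixed points of $\sigma\in S_k$, $a^{\uparrow m}=a(a+1)\cdots(a+m-1)$ and $a^{\downarrow m}=a(a-1)\cdots(a-m+1)$ (both equal to $1$ for $m=0$). For $m\ge1$, the ascension function is \[A_{k,m}(\sigma)=\sum_{t=0}^{\mathrm{fix}(\sigma)}(-1)^{k-t}\binom{\mathrm{fix}(\sigma)}{t}\frac{1}{m^{\uparrow(k-t)}},\] and the descension function is \[D_{k,n}(\sigma)=\mathrm{sgn}(\sigma)\sum_{t=0}^{\mathrm{fix}(\sigma)}\binom{\mathrm{fix}(\sigma)}{t}\frac{1}{n^{\downarrow(k-t)}}.\] For $m\ge k$, the unitary Weingarten function is \[\mathrm{Wg}_{k,m}(\pi)=\mathbb{E}\left[u_{11}u_{22}\cdots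 u_{kk}\,\overline{u_{1\pi(1)}u_{2\pi(2)}\cdots u_{k\pi(k)}}\right]\qquad(\pi\in S_k),\] where $U=(u_{ij})$ is a Haar-distributed random matrix in the unitary group $\mathrm{U}(m)$. Then \[A_{k,n+1}*D_{k,n}=\delta_{e}\qquad\text{and}\qquad \mathrm{Wg}_{k,n}=D_{k,n}*\mathrm{Wg}_{k,n+1}.\] -/

import Mathlib

namespace WgCalc

noncomputable section

/-- The number of fixed points of a permutation of `{1, …, k}`. -/
def fixCount {k : ℕ} (σ : Equiv.Perm (Fin k)) : ℕ :=
  (Finset.univ.filter fun i : Fin k => σ i = i).card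

/-- The convolution product on the group algebra of the symmetric group, whose elements are
the complex-valued functions on the group. -/
def conv {k : ℕ} (f g : Equiv.Perm (Fin k) → ℂ) : Equiv.Perm (Fin k) → ℂ :=
  fun π => ∑ σ : Equiv.Perm (Fin k), f σ * g (σ⁻¹ * π)

/-- The Dirac function at the identity permutation. -/
def diracId (k : ℕ) : Equiv.Perm (Fin k) → ℂ :=
  fun σ => if σ = 1 then 1 else 0

/-- The ascension function. Here `n.ascFactorial m = n (n + 1) ⋯ (n + m - 1)`. -/
def ascension (k n : ℕ) : Equiv.Perm (Fin k) → ℂ :=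
  fun σ => ∑ t ∈ Finset.range (fixCount σ + 1),
    (-1 : ℂ) ^ (k - t) * ((fixCount σ).choose t : ℂ) * (1 / (n.ascFactorial (k - t) : ℂ))

/-- The descension function. Here `n.descFactorial m = n (n - 1) ⋯ (n - m + 1)`, which does not
vanish for `m ≤ k ≤ n`. -/
def descension (k n : ℕ) : Equiv.Perm (Fin k) → ℂ :=
  fun σ => ((Equiv.Perm.sign σ : ℤ) : ℂ) * ∑ t ∈ Finset.range (fixCount σ + 1),
    ((fixCount σ).choose t : ℂ) * (1 / (n.descFactorial (k - t) : ℂ))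

/-- The Borel σ-algebra of the unitary group `U(n)`. -/
instance unitaryGroupMeasurableSpace (n : ℕ) :
    MeasurableSpace (Matrix.unitaryGroup (Fin n) ℂ) :=
  borel _

instance unitaryGroupBorelSpace (n : ℕ) :
    BorelSpace (Matrix.unitaryGroup (Fin n) ℂ) :=
  ⟨rfl⟩

instance unitaryGroupCompactSpace (n : ℕ) :
    CompactSpace (Matrix.unitaryGroup (Fin n) ℂ) := by
  have hK : IsCompact (X := Matrix (Fin n) (Fin n) ℂ)
      (Set.univ.pi fun _ : Fin n => Set.univ.pi fun _ : Fin n => Metric.closedBall (0 : ℂ) 1) :=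
    isCompact_univ_pi fun _ => isCompact_univ_pi fun _ => isCompact_closedBall 0 1
  have hc : IsClosed {U : Matrix (Fin n) (Fin n) ℂ | star U * U = 1 ∧ U * star U = 1} :=
    (isClosed_eq (continuous_star.mul continuous_id) continuous_const).inter
      (isClosed_eq (continuous_id.mul continuous_star) continuous_const)
  have hsub : (Matrix.unitaryGroup (Fin n) ℂ : Set (Matrix (Fin n) (Fin n) ℂ)) ⊆
      Set.univ.pi fun _ : Fin n => Set.univ.pi fun _ : Fin n => Metric.closedBall (0 : ℂ) 1 := by
    intro U hU i _ j _
    simpa using entry_norm_bound_of_unitary hU i j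
  exact isCompact_iff_compactSpace.mp (hK.of_isClosed_subset hc hsub)

/-- The Haar measure of the compact group `U(n)`, normalized to have total mass one. -/
def unitaryHaar (n : ℕ) : MeasureTheory.Measure (Matrix.unitaryGroup (Fin n) ℂ) :=
  MeasureTheory.Measure.haarMeasure ⊤

instance unitaryHaarIsHaarMeasure (n : ℕ) : (unitaryHaar n).IsHaarMeasure := by
  unfold unitaryHaar
  infer_instance

instance unitaryHaarIsProbabilityMeasure (n : ℕ) :
    MeasureTheory.IsProbabilityMeasure (unitaryHaar n) :=
  ⟨MeasureTheory.Measure.haarMeasure_self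
    (K₀ := (⊤ : TopologicalSpace.PositiveCompacts (Matrix.unitaryGroup (Fin n) ℂ)))⟩

/-- The unitary Weingarten function for `k ≤ n`:
`Wg(π) = 𝔼[u₁₁ u₂₂ ⋯ u_{kk} conj (u_{1,π(1)} u_{2,π(2)} ⋯ u_{k,π(k)})]`,
where `U = (u_{ij})` is Haar distributed on `U(n)`. -/
def weingarten (k n : ℕ) (h : k ≤ n) : Equiv.Perm (Fin k) → ℂ :=
  fun π => ∫ U : Matrix.unitaryGroup (Fin n) ℂ,
    (∏ i : Fin k, (U : Matrix (Fin n) (Fin n) ℂ) (Fin.castLE h i) (Fin.castLE h i)) *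
      star (∏ i : Fin k, (U : Matrix (Fin n) (Fin n) ℂ) (Fin.castLE h i) (Fin.castLE h (π i)))
    ∂(unitaryHaar n)

end

end WgCalc

/-!
Both identities are proved for all subsets `S` of the index set, by adding one point `x` at a time.
Let `J = ∑ y ∈ S, (x y)` be the Jucys–Murphy element of `x`. Grouping the permutations by the sets
that contain their supports writes the ascension and descension functions as weighted sums of
symmetrizers and antisymmetrizers of subsets, and the recursions of the rising and falling
factorials turn into

* `(n + J) * D_n(S ∪ {x}) = (n + 1 + J) * D_n(S)`,
* `(n + 1 + J) * A_{n+1}(S ∪ {x}) = (n + J) * A_{n+1}(S)`.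

The Weingarten functions satisfy `(n + J) * Wg_n(S ∪ {x}) = Wg_n(S)`, which is the orthogonality of
the rows of a unitary matrix. As `J` commutes with `D_n(S)`, the three recursions propagate
`D_n * A_{n+1} = 1` and `Wg_n = D_n * Wg_{n+1}` from `S` to `S ∪ {x}` once the factor `n + J` is
cancelled. It is invertible because it divides `D_n(S)`, whose inverse is `A_{n+1}(S)`.

Expanding the orthogonality relation repeats a column. A unitary mixing of two columns, averaged
over the fourth roots of unity, reduces such a moment to moments with distinct columns.
-/

namespace WgCalc

open Equiv Finset MeasureTheory

section PermutationsOfSubsets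

variable {ι : Type*} [Fintype ι] [DecidableEq ι] {σ : Perm ι} {T : Finset ι} {x y : ι}

theorem apply_mem_iff_of_support_subset (hσ : σ.support ⊆ T) (i : ι) : σ i ∈ T ↔ i ∈ T := by
  by_cases hi : i ∈ σ.support
  · exact iff_of_true (hσ (Perm.apply_mem_support.2 hi)) (hσ hi)
  · rw [Perm.notMem_support.1 hi]

theorem support_swap_subset (hx : x ∈ T) (hy : y ∈ T) : (swap x y).support ⊆ T := by
  rcases eq_or_ne x y with rfl | hxy
  · simp
  · simp [Perm.support_swap hxy, insert_subset_iff, hx, hy]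

theorem support_mul_subset {τ : Perm ι} (hσ : σ.support ⊆ T) (hτ : τ.support ⊆ T) :
    (σ * τ).support ⊆ T :=
  (Perm.support_mul_le σ τ).trans (union_subset hσ hτ)

theorem support_mul_subset_iff_right {τ : Perm ι} (hσ : σ.support ⊆ T) :
    (σ * τ).support ⊆ T ↔ τ.support ⊆ T := by
  refine ⟨fun h => ?_, support_mul_subset hσ⟩
  simpa using support_mul_subset (σ := σ⁻¹) (by simpa using hσ) h

theorem support_mul_subset_iff_left {τ : Perm ι} (hτ : τ.support ⊆ T) :
    (σ * τ).support ⊆ T ↔ σ.support ⊆ T := by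
  rw [← Perm.support_inv, mul_inv_rev, support_mul_subset_iff_right (by simpa using hτ),
    Perm.support_inv]

theorem support_subset_iff_support_subset_insert (hx : x ∉ T) :
    σ.support ⊆ T ↔ σ.support ⊆ insert x T ∧ σ x = x := by
  refine ⟨fun h => ⟨h.trans (subset_insert x T), Perm.notMem_support.1 (notMem_mono h hx)⟩, ?_⟩
  rintro ⟨h, hσx⟩
  exact (subset_insert_iff_of_notMem (Perm.notMem_support.2 hσx)).1 h

end PermutationsOfSubsets

section Symmetrizers

variable {ι A : Type*} [Fintype ι] [DecidableEq ι] [Semiring A] (ρ : Perm ι →* A)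
  {S T : Finset ι} {x : ι} {σ : Perm ι}

/-- The image under a representation `ρ` of the Jucys–Murphy element of the group algebra attached
to a point `x` and a set `S`: the sum of the transpositions `(x y)` for `y ∈ S`. -/
def jucysMurphy (x : ι) (S : Finset ι) : A :=
  ∑ y ∈ S, ρ (swap x y)

/-- The image under a representation `ρ` of the symmetrizer of the group algebra attached to a set
`T`: the sum of the permutations that fix every point outside `T`. The antisymmetrizer is obtained
by twisting `ρ` by the sign. -/
def symmetrizer (T : Finset ι) : A :=
  ∑ σ : Perm ι with σ.support ⊆ T, ρ σ

@[simp]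
theorem symmetrizer_empty : symmetrizer ρ ∅ = 1 := by
  simp [symmetrizer, filter_eq']

theorem apply_mul_symmetrizer (hσ : σ.support ⊆ T) :
    ρ σ * symmetrizer ρ T = symmetrizer ρ T := by
  rw [symmetrizer, mul_sum]
  exact sum_equiv (Equiv.mulLeft σ) (by simp [support_mul_subset_iff_right hσ]) (by simp)

theorem apply_mul_symmetrizer_eq_symmetrizer_map_mul (σ : Perm ι) (T : Finset ι) :
    ρ σ * symmetrizer ρ T = symmetrizer ρ (T.map σ.toEmbedding) * ρ σ := by
  rw [symmetrizer, symmetrizer, mul_sum, sum_mul]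
  exact sum_equiv (MulAut.conj σ).toEquiv (by simp [Perm.support_conj]) (by simp [← map_mul])

theorem swap_mul_symmetrizer_insert {y : ι} (hx : x ∉ T) (hy : y ∉ T) :
    ρ (swap x y) * symmetrizer ρ (insert x T) =
      symmetrizer ρ (insert y T) * ρ (swap x y) := by
  have hT : T.map (swap x y).toEmbedding = T := by
    rw [map_eq_image]
    refine (image_congr fun i hi => ?_).trans image_id
    exact swap_apply_of_ne_of_ne (ne_of_mem_of_not_mem hi hx) (ne_of_mem_of_not_mem hi hy)
  rw [apply_mul_symmetrizer_eq_symmetrizer_map_mul, map_insert, hT, Equiv.coe_toEmbedding,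
    swap_apply_left]

theorem symmetrizer_insert_eq_sum_cosets (hx : x ∉ T) :
    symmetrizer ρ (insert x T) = ∑ y ∈ insert x T, symmetrizer ρ T * ρ (swap x y) := by
  have hswap {y : ι} (hy : y ∈ insert x T) : (swap x y).support ⊆ insert x T :=
    support_swap_subset (mem_insert_self x T) hy
  simp only [symmetrizer, sum_mul, ← map_mul]
  rw [← sum_product']
  refine sum_bij' (fun σ _ => (σ.symm x, σ * swap x (σ.symm x))) (fun p _ => p.2 * swap x p.1)
    (fun σ hσ => ?_) (fun p hp => ?_) (fun σ _ => by simp) (fun p hp => ?_) (fun σ _ => by simp)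
  · rw [mem_filter_univ] at hσ
    have hy : σ.symm x ∈ insert x T := by
      rw [← apply_mem_iff_of_support_subset hσ, apply_symm_apply]
      exact mem_insert_self x T
    rw [mem_product, mem_filter_univ, support_subset_iff_support_subset_insert hx,
      support_mul_subset_iff_left (hswap hy)]
    exact ⟨hy, hσ, by simp⟩
  · simp only [mem_product, mem_filter_univ] at hp ⊢
    exact support_mul_subset (hp.2.trans (subset_insert x T)) (hswap hp.1)
  · simp only [mem_product, mem_filter_univ] at hp
    have hfix : p.2.symm x = x := by
      rw [symm_apply_eq, Perm.notMem_support.1 (notMem_mono hp.2 hx)]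
    simp [Perm.mul_def, hfix, ← Equiv.trans_assoc]

theorem symmetrizer_insert (hx : x ∉ T) :
    symmetrizer ρ (insert x T) = symmetrizer ρ T + symmetrizer ρ T * jucysMurphy ρ x T := by
  rw [symmetrizer_insert_eq_sum_cosets ρ hx, sum_insert hx, swap_self, ← Perm.one_def, map_one,
    mul_one, jucysMurphy, mul_sum]

theorem jucysMurphy_mul_symmetrizer_insert (x : ι) (T : Finset ι) :
    jucysMurphy ρ x T * symmetrizer ρ (insert x T) = #T • symmetrizer ρ (insert x T) := by
  rw [jucysMurphy, sum_mul, ← sum_const]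
  exact sum_congr rfl fun y hy => apply_mul_symmetrizer ρ
    (support_swap_subset (mem_insert_self x T) (mem_insert_of_mem hy))

theorem commute_apply_jucysMurphy (hσ : σ.support ⊆ S) (hx : x ∉ S) :
    Commute (ρ σ) (jucysMurphy ρ x S) := by
  rw [Commute, SemiconjBy, jucysMurphy, mul_sum, sum_mul]
  refine sum_equiv σ (fun i => (apply_mem_iff_of_support_subset hσ i).symm) fun y _ => ?_
  rw [← map_mul, ← map_mul, mul_swap_eq_swap_mul, Perm.notMem_support.1 (notMem_mono hσ hx)]

theorem commute_symmetrizer_jucysMurphy (hTS : T ⊆ S) (hx : x ∉ S) :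
    Commute (symmetrizer ρ T) (jucysMurphy ρ x S) :=
  Commute.sum_left _ _ _ fun _ hσ =>
    commute_apply_jucysMurphy ρ (((mem_filter_univ _).1 hσ).trans hTS) hx

end Symmetrizers

section WeightedSymmetrizers

variable {ι K A : Type*} [DecidableEq ι]

theorem sum_powerset_sum_sdiff_insert {M : Type*} [AddCommMonoid M] (S : Finset ι)
    (f : Finset ι → ι → M) :
    ∑ T ∈ S.powerset, ∑ y ∈ S \ T, f (insert y T) y = ∑ T ∈ S.powerset, ∑ y ∈ T, f T y := by
  rw [sum_sigma', sum_sigma']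
  refine sum_bij' (fun p _ => ⟨insert p.2 p.1, p.2⟩) (fun p _ => ⟨p.1.erase p.2, p.2⟩)
    (by grind) (by grind) ?_ ?_ (fun _ _ => rfl)
  · rintro ⟨T, y⟩ h
    simp only [mem_sigma, mem_sdiff] at h
    simp [erase_insert h.2.2]
  · rintro ⟨T, y⟩ h
    simp only [mem_sigma] at h
    simp [insert_erase h.2]

variable [Fintype ι] [CommRing K] [Ring A] [Algebra K A] (ρ : Perm ι →* A) (w : ℕ → K)
  {S : Finset ι} {x : ι}

/-- The sum of the symmetrizers of all subsets `T` of `S`, weighted by a function of the size of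
`T`. The ascension and descension functions are of this form. -/
def weightedSymmetrizer (S : Finset ι) : A :=
  ∑ T ∈ S.powerset, w #T • symmetrizer ρ T

theorem weightedSymmetrizer_empty : weightedSymmetrizer ρ w ∅ = w 0 • 1 := by
  simp [weightedSymmetrizer]

theorem weightedSymmetrizer_insert (hx : x ∉ S) :
    weightedSymmetrizer ρ w (insert x S) = weightedSymmetrizer ρ w S +
      ∑ T ∈ S.powerset, w (#T + 1) • symmetrizer ρ (insert x T) := by
  rw [weightedSymmetrizer, sum_powerset_insert hx, weightedSymmetrizer]
  congr 1
  refine sum_congr rfl fun T hT => ?_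
  rw [card_insert_of_notMem (notMem_mono (mem_powerset.1 hT) hx)]

theorem commute_weightedSymmetrizer_jucysMurphy (hx : x ∉ S) :
    Commute (weightedSymmetrizer ρ w S) (jucysMurphy ρ x S) :=
  Commute.sum_left _ _ _ fun _ hT =>
    (commute_symmetrizer_jucysMurphy ρ (mem_powerset.1 hT) hx).smul_left _

variable {w} {z : K}

theorem smul_one_sub_jucysMurphy_mul_sum_symmetrizer_insert (hx : x ∉ S)
    (hw : ∀ t ≤ #S, w t = (z - t) * w (t + 1)) :
    (z • 1 - jucysMurphy ρ x S) * ∑ T ∈ S.powerset, w (#T + 1) • symmetrizer ρ (insert x T) =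
      weightedSymmetrizer ρ w S := by
  have hterm : ∀ T ∈ S.powerset,
      (z • 1 - jucysMurphy ρ x S) * (w (#T + 1) • symmetrizer ρ (insert x T)) =
        w #T • symmetrizer ρ T + ∑ y ∈ T, w #T • (symmetrizer ρ T * ρ (swap x y)) -
          ∑ y ∈ S \ T, w #(insert y T) • (symmetrizer ρ (insert y T) * ρ (swap x y)) := by
    intro T hT
    have hTS : T ⊆ S := mem_powerset.1 hT
    have hxT : x ∉ T := notMem_mono hTS hx
    have hinside : (z • 1 - jucysMurphy ρ x T) * (w (#T + 1) • symmetrizer ρ (insert x T)) =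
        w #T • symmetrizer ρ (insert x T) := by
      rw [hw _ (card_le_card hTS), sub_mul, mul_smul_comm _ (jucysMurphy ρ x T),
        jucysMurphy_mul_symmetrizer_insert]
      simp only [smul_mul_assoc, one_mul]
      module
    have houtside : jucysMurphy ρ x (S \ T) * (w (#T + 1) • symmetrizer ρ (insert x T)) =
        ∑ y ∈ S \ T, w #(insert y T) • (symmetrizer ρ (insert y T) * ρ (swap x y)) := by
      rw [jucysMurphy, sum_mul]
      refine sum_congr rfl fun y hy => ?_
      have hyT : y ∉ T := (mem_sdiff.1 hy).2
      rw [mul_smul_comm, swap_mul_symmetrizer_insert ρ hxT hyT, card_insert_of_notMem hyT]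
    have hsplit : jucysMurphy ρ x S = jucysMurphy ρ x (S \ T) + jucysMurphy ρ x T :=
      (sum_sdiff hTS).symm
    rw [hsplit, ← sub_sub, sub_right_comm, sub_mul, hinside, houtside, symmetrizer_insert ρ hxT,
      smul_add, jucysMurphy, mul_sum, smul_sum]
  rw [mul_sum, sum_congr rfl hterm, sum_sub_distrib, sum_add_distrib,
    sum_powerset_sum_sdiff_insert S fun T y => w #T • (symmetrizer ρ T * ρ (swap x y)),
    add_sub_cancel_right, weightedSymmetrizer]

theorem weightedSymmetrizer_insert_recursion (hx : x ∉ S)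
    (hw : ∀ t ≤ #S, w t = (z - t) * w (t + 1)) :
    (z • 1 - jucysMurphy ρ x S) * weightedSymmetrizer ρ w (insert x S) =
      ((z + 1) • 1 - jucysMurphy ρ x S) * weightedSymmetrizer ρ w S := by
  rw [weightedSymmetrizer_insert ρ w hx, mul_add,
    smul_one_sub_jucysMurphy_mul_sum_symmetrizer_insert ρ hx hw, add_smul, one_smul]
  noncomm_ring

end WeightedSymmetrizers

section AscensionDescension

variable {ι A : Type*} [Fintype ι] [DecidableEq ι] [Ring A] (ρ : Perm ι →* A)

/-- The tensor product of a representation `ρ` with the sign character. It turns the symmetrizers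
into antisymmetrizers. -/
def signTwist : Perm ι →* A where
  toFun σ := Perm.sign σ • ρ σ
  map_one' := by simp
  map_mul' σ τ := by simp [smul_mul_smul_comm]

theorem signTwist_apply (σ : Perm ι) : signTwist ρ σ = Perm.sign σ • ρ σ :=
  rfl

variable {S : Finset ι} {x : ι}

theorem jucysMurphy_signTwist (hx : x ∉ S) :
    jucysMurphy (signTwist ρ) x S = -jucysMurphy ρ x S := by
  rw [jucysMurphy, jucysMurphy, ← sum_neg_distrib]
  refine sum_congr rfl fun y hy => ?_
  rw [signTwist_apply, Perm.sign_swap (ne_of_mem_of_not_mem hy hx).symm, Units.smul_def,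
    Units.coe_neg_one, neg_one_smul]

variable (K : Type*) [Field K] [Algebra K A] {n : ℕ}

/-- The image under a representation `ρ` of the descension function of the symmetric group of a
set `S`, as an element of the group algebra. -/
def descensionOn (n : ℕ) (S : Finset ι) : A :=
  weightedSymmetrizer (signTwist ρ) (fun t => (1 / n.descFactorial t : K)) S

/-- The image under a representation `ρ` of the ascension function of the symmetric group of a
set `S`, as an element of the group algebra. -/
def ascensionOn (n : ℕ) (S : Finset ι) : A :=
  weightedSymmetrizer ρ (fun t => (-1 : K) ^ t * (1 / n.ascFactorial t)) S

theorem descensionOn_empty : descensionOn ρ K n ∅ = 1 := by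
  simp [descensionOn, weightedSymmetrizer_empty]

theorem ascensionOn_empty : ascensionOn ρ K n ∅ = 1 := by
  simp [ascensionOn, weightedSymmetrizer_empty]

theorem commute_descensionOn_natCast_add_jucysMurphy (m : ℕ) (hx : x ∉ S) :
    Commute (descensionOn ρ K n S) (m + jucysMurphy ρ x S) := by
  refine (Nat.cast_commute m _).symm.add_right ?_
  rw [← Commute.neg_right_iff, ← jucysMurphy_signTwist ρ hx]
  exact commute_weightedSymmetrizer_jucysMurphy _ _ hx

variable [CharZero K]

theorem one_div_descFactorial_eq {t : ℕ} (ht : t < n) :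
    (1 / n.descFactorial t : K) = (n - t) * (1 / n.descFactorial (t + 1)) := by
  have hn : (n - t : K) ≠ 0 := sub_ne_zero.2 (by exact_mod_cast ht.ne')
  have hdesc : (n.descFactorial t : K) ≠ 0 := by
    exact_mod_cast (Nat.descFactorial_pos.2 ht.le).ne'
  rw [Nat.descFactorial_succ, Nat.cast_mul, Nat.cast_sub ht.le]
  field_simp

theorem neg_one_pow_mul_one_div_ascFactorial_eq (n t : ℕ) :
    (-1 : K) ^ t * (1 / (n + 1).ascFactorial t) =
      (-(n + 1) - t) * ((-1) ^ (t + 1) * (1 / (n + 1).ascFactorial (t + 1))) := by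
  have hn : (n + 1 + t : K) ≠ 0 := by exact_mod_cast (Nat.add_pos_left n.succ_pos t).ne'
  have hasc : ((n + 1).ascFactorial t : K) ≠ 0 := by
    exact_mod_cast (Nat.ascFactorial_pos n t).ne'
  rw [Nat.ascFactorial_succ]
  push_cast
  field_simp
  ring

variable {K}

theorem natCast_add_jucysMurphy_mul_sum_symmetrizer_insert (hx : x ∉ S) (hS : #S < n) :
    (n + jucysMurphy ρ x S) * ∑ T ∈ S.powerset,
      (1 / n.descFactorial (#T + 1) : K) • symmetrizer (signTwist ρ) (insert x T) =
        descensionOn ρ K n S := by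
  have h := smul_one_sub_jucysMurphy_mul_sum_symmetrizer_insert (signTwist ρ) hx
    fun t ht => one_div_descFactorial_eq K (ht.trans_lt hS)
  rwa [jucysMurphy_signTwist ρ hx, sub_neg_eq_add, Nat.cast_smul_eq_nsmul, nsmul_one] at h

theorem natCast_add_jucysMurphy_mul_descensionOn_insert (hx : x ∉ S) (hS : #S < n) :
    (n + jucysMurphy ρ x S) * descensionOn ρ K n (insert x S) =
      (n + 1 + jucysMurphy ρ x S) * descensionOn ρ K n S := by
  have h := weightedSymmetrizer_insert_recursion (signTwist ρ) hx
    fun t ht => one_div_descFactorial_eq K (ht.trans_lt hS)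
  rwa [jucysMurphy_signTwist ρ hx, sub_neg_eq_add, sub_neg_eq_add, add_smul, one_smul,
    Nat.cast_smul_eq_nsmul, nsmul_one] at h

theorem natCast_add_one_add_jucysMurphy_mul_ascensionOn_insert (hx : x ∉ S) :
    (n + 1 + jucysMurphy ρ x S) * ascensionOn ρ K (n + 1) (insert x S) =
      (n + jucysMurphy ρ x S) * ascensionOn ρ K (n + 1) S := by
  have h := weightedSymmetrizer_insert_recursion ρ hx
    fun t _ => neg_one_pow_mul_one_div_ascFactorial_eq K n t
  simp only [neg_add_rev, neg_add_cancel_comm, add_smul, neg_smul, one_smul, Nat.cast_smul_eq_nsmul,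
    nsmul_one] at h
  rw [← neg_inj, ← neg_mul, ← neg_mul]
  convert h using 2 <;> abel

variable [IsDedekindFiniteMonoid A]

/-- Both convolution identities propagate from `S` to `insert x S` in this way: `descensionOn`
satisfies the same recursion as the quotient of the families `f` and `g`. -/
theorem descensionOn_insert_mul_eq {f f' g g' l : A} (hx : x ∉ S) (hS : #S < n)
    (hD : IsUnit (descensionOn ρ K n S)) (hl : Commute (descensionOn ρ K n S) l)
    (hf : (n + jucysMurphy ρ x S) * f' = l * f)
    (hg : (n + 1 + jucysMurphy ρ x S) * g' = l * g) (h : descensionOn ρ K n S * g = f) :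
    descensionOn ρ K n (insert x S) * g' = f' := by
  have hunit : IsUnit (n + jucysMurphy ρ x S) := by
    rw [← natCast_add_jucysMurphy_mul_sum_symmetrizer_insert ρ hx hS] at hD
    exact isUnit_of_mul_isUnit_left hD
  have hcomm := commute_descensionOn_natCast_add_jucysMurphy ρ K (n := n) (n + 1) hx
  rw [Nat.cast_add_one] at hcomm
  refine hunit.mul_left_cancel ?_
  calc (n + jucysMurphy ρ x S) * (descensionOn ρ K n (insert x S) * g')
    _ = descensionOn ρ K n S * ((n + 1 + jucysMurphy ρ x S) * g') := by
      rw [← mul_assoc, natCast_add_jucysMurphy_mul_descensionOn_insert ρ hx hS, ← hcomm.eq,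
        mul_assoc]
    _ = (n + jucysMurphy ρ x S) * f' := by rw [hg, ← mul_assoc, hl.eq, mul_assoc, h, hf]

theorem descensionOn_mul_ascensionOn (hS : #S ≤ n) :
    descensionOn ρ K n S * ascensionOn ρ K (n + 1) S = 1 := by
  induction S using Finset.induction_on with
  | empty => rw [descensionOn_empty, ascensionOn_empty, one_mul]
  | insert x S hx ih =>
    rw [card_insert_of_notMem hx] at hS
    have h := ih (Nat.le_of_succ_le hS)
    exact descensionOn_insert_mul_eq ρ hx hS (.of_mul_eq_one _ h)
      (commute_descensionOn_natCast_add_jucysMurphy ρ K n hx) rfl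
      (natCast_add_one_add_jucysMurphy_mul_ascensionOn_insert ρ hx) h

theorem isUnit_descensionOn (hS : #S ≤ n) : IsUnit (descensionOn ρ K n S) :=
  .of_mul_eq_one _ (descensionOn_mul_ascensionOn ρ hS)

end AscensionDescension

section CompactGroups

variable {G : Type*} [Group G] [TopologicalSpace G] [IsTopologicalGroup G] [CompactSpace G]
  [MeasurableSpace G] [BorelSpace G]

theorem isMulRightInvariant_of_isHaarMeasure (μ : Measure G) [μ.IsHaarMeasure]
    [IsProbabilityMeasure μ] : μ.IsMulRightInvariant where
  map_mul_right_eq_self g := by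
    have : IsProbabilityMeasure (μ.map (· * g)) :=
      Measure.isProbabilityMeasure_map (by fun_prop)
    exact Measure.isHaarMeasure_eq_of_isProbabilityMeasure _ _

end CompactGroups

section UnitaryMatrices

variable {ι : Type*} [Fintype ι] [DecidableEq ι]

/-- The unitary permutation matrix whose right multiplication replaces the column `j` of a matrix
by its column `σ j`. -/
def columnPerm (σ : Perm ι) : Matrix.unitaryGroup ι ℂ :=
  ⟨σ⁻¹.permMatrix ℂ, by
    rw [Matrix.mem_unitaryGroup_iff, Matrix.star_eq_conjTranspose, Matrix.conjTranspose_permMatrix,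
      ← Matrix.permMatrix_mul]
    simp⟩

theorem mul_columnPerm_apply (U : Matrix.unitaryGroup ι ℂ) (σ : Perm ι) (i j : ι) :
    (U * columnPerm σ) i j = U i (σ j) := by
  simp [columnPerm, Perm.inv_def, PEquiv.mul_toMatrix_toPEquiv]

/-- The unitary diagonal matrix whose right multiplication scales the column `q` by `ω`. -/
def columnPhase (q : ι) (ω : unitary ℂ) : Matrix.unitaryGroup ι ℂ :=
  ⟨Matrix.diagonal (Function.update 1 q ω), by
    rw [Matrix.mem_unitaryGroup_iff, Matrix.star_eq_conjTranspose, Matrix.diagonal_conjTranspose,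
      Matrix.diagonal_mul_diagonal, ← Matrix.diagonal_one]
    refine congrArg _ (funext fun j => ?_)
    rcases eq_or_ne j q with rfl | hj
    · simpa using Unitary.mul_star_self_of_mem ω.2
    · simp [hj]⟩

theorem mul_columnPhase_apply_self (U : Matrix.unitaryGroup ι ℂ) (q : ι) (ω : unitary ℂ) (i : ι) :
    (U * columnPhase q ω) i q = ω * U i q := by
  simp [columnPhase, mul_comm]

theorem mul_columnPhase_apply_of_ne (U : Matrix.unitaryGroup ι ℂ) {j q : ι} (hj : j ≠ q)
    (ω : unitary ℂ) (i : ι) : (U * columnPhase q ω) i j = U i j := by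
  simp [columnPhase, hj]

/-- A unitary square root of the permutation matrix of a transposition. Its right multiplication
mixes the columns `p` and `q` with weights of equal modulus. -/
noncomputable def sqrtSwap (p q : ι) : Matrix.unitaryGroup ι ℂ :=
  ⟨((1 + Complex.I) / 2) • 1 + ((1 - Complex.I) / 2) • (swap p q).permMatrix ℂ, by
    have hsq : (swap p q).permMatrix ℂ * (swap p q).permMatrix ℂ = 1 := by
      rw [← Matrix.permMatrix_mul, swap_mul_self, Matrix.permMatrix_one]
    have hstar : star ((1 + Complex.I) / 2) = (1 - Complex.I) / 2 := by simp [sub_eq_add_neg]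
    have hstar' : star ((1 - Complex.I) / 2) = (1 + Complex.I) / 2 := by simp
    rw [Matrix.mem_unitaryGroup_iff, Matrix.star_eq_conjTranspose]
    simp only [Matrix.conjTranspose_add, Matrix.conjTranspose_smul, Matrix.conjTranspose_one,
      Matrix.conjTranspose_permMatrix, swap_inv, add_mul, mul_add, smul_mul_smul_comm, hsq, one_mul,
      mul_one, hstar, hstar']
    match_scalars
    · linear_combination (-1 / 2 : ℂ) * Complex.I_sq
    · linear_combination (1 / 2 : ℂ) * Complex.I_sq⟩

theorem mul_sqrtSwap_apply (U : Matrix.unitaryGroup ι ℂ) (p q i j : ι) :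
    (U * sqrtSwap p q) i j =
      (1 + Complex.I) / 2 * U i j + (1 - Complex.I) / 2 * U i (swap p q j) := by
  simp [sqrtSwap, mul_add, PEquiv.mul_toMatrix_toPEquiv]

end UnitaryMatrices

section RepeatedColumns

variable {n : ℕ}

theorem integral_unitaryHaar_mul_right (f : Matrix.unitaryGroup (Fin n) ℂ → ℂ)
    (V : Matrix.unitaryGroup (Fin n) ℂ) :
    ∫ U, f (U * V) ∂unitaryHaar n = ∫ U, f U ∂unitaryHaar n :=
  have := isMulRightInvariant_of_isHaarMeasure (unitaryHaar n)
  integral_mul_right_eq_self f V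

theorem integrable_unitaryHaar {f : Matrix.unitaryGroup (Fin n) ℂ → ℂ} (hf : Continuous f) :
    Integrable f (unitaryHaar n) :=
  hf.integrable_of_hasCompactSupport (.of_compactSpace f)

@[fun_prop]
theorem continuous_entry (i j : Fin n) :
    Continuous fun U : Matrix.unitaryGroup (Fin n) ℂ => U i j :=
  continuous_subtype_val.matrix_elem i j

theorem sum_range_four_polarization (z₁ z₂ z₃ z₄ w₁ w₂ w₃ w₄ : ℂ) :
    ∑ m ∈ range 4, (z₁ + Complex.I ^ m * w₁) * (z₂ + Complex.I ^ m * w₂) *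
        star ((z₃ + Complex.I ^ m * w₃) * (z₄ + Complex.I ^ m * w₄)) =
      4 * (z₁ * z₂ * star (z₃ * z₄) + w₁ * w₂ * star (w₃ * w₄) +
        (z₁ * w₂ + w₁ * z₂) * star (z₃ * w₄ + w₃ * z₄)) := by
  simp only [sum_range_succ, range_zero, sum_empty, pow_succ, pow_zero, one_mul, Complex.I_mul_I,
    neg_mul, star_add, star_mul', Complex.star_def, Complex.conj_I, zero_add,
    map_neg, map_one]
  ring_nf
  simp only [Complex.I_sq, Complex.I_pow_four]
  ring

variable {p q : Fin n} {X : Matrix.unitaryGroup (Fin n) ℂ → ℂ}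

theorem I_mem_unitary : Complex.I ∈ unitary ℂ := by
  simp [Unitary.mem_iff]

theorem integral_mul_repeated_column_eq_integral_mix (hpq : p ≠ q)
    (hX : ∀ U V : Matrix.unitaryGroup (Fin n) ℂ,
      (∀ i j, j ≠ p → j ≠ q → U i j = V i j) → X U = X V)
    (i₁ i₂ i₃ i₄ : Fin n) {ω : ℂ} (hω : ω ∈ unitary ℂ) :
    ∫ U, X U * (U i₁ p * U i₂ p * star (U i₃ p * U i₄ p)) ∂unitaryHaar n =
      ∫ U, X U * ((U i₁ p + ω * U i₁ q) * (U i₂ p + ω * U i₂ q) *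
        star ((U i₃ p + ω * U i₃ q) * (U i₄ p + ω * U i₄ q))) / 4 ∂unitaryHaar n := by
  let V := columnPhase q ⟨Complex.I * ω, mul_mem I_mem_unitary hω⟩ * sqrtSwap p q
  have hV (U : Matrix.unitaryGroup (Fin n) ℂ) (i : Fin n) :
      (U * V) i p = (1 + Complex.I) / 2 * (U i p + ω * U i q) := by
    rw [← mul_assoc, mul_sqrtSwap_apply, swap_apply_left, mul_columnPhase_apply_self,
      mul_columnPhase_apply_of_ne U hpq]
    linear_combination (-1 / 2 : ℂ) * ω * U i q * Complex.I_sq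
  have hXV (U : Matrix.unitaryGroup (Fin n) ℂ) : X (U * V) = X U := by
    refine hX _ _ fun i j hp hq => ?_
    rw [← mul_assoc, mul_sqrtSwap_apply, swap_apply_of_ne_of_ne hp hq,
      mul_columnPhase_apply_of_ne U hq]
    ring
  rw [← integral_unitaryHaar_mul_right _ V]
  refine integral_congr_ae (.of_forall fun U => ?_)
  simp only [hV, hXV]
  have hmod : ((1 + Complex.I) / 2) ^ 2 * star ((1 + Complex.I) / 2) ^ 2 = 1 / 4 := by
    have hstar : star ((1 + Complex.I) / 2) = (1 - Complex.I) / 2 := by simp [sub_eq_add_neg]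
    rw [hstar, ← mul_pow, div_mul_div_comm, ← sq_sub_sq, Complex.I_sq]
    norm_num
  simp only [star_mul']
  linear_combination X U * ((U i₁ p + ω * U i₁ q) * (U i₂ p + ω * U i₂ q) *
    (star (U i₃ p + ω * U i₃ q) * star (U i₄ p + ω * U i₄ q))) * hmod

theorem four_mul_integral_mul_repeated_column (hpq : p ≠ q) (hXc : Continuous X)
    (hX : ∀ U V : Matrix.unitaryGroup (Fin n) ℂ,
      (∀ i j, j ≠ p → j ≠ q → U i j = V i j) → X U = X V)
    (i₁ i₂ i₃ i₄ : Fin n) :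
    4 * ∫ U, X U * (U i₁ p * U i₂ p * star (U i₃ p * U i₄ p)) ∂unitaryHaar n =
      ∫ U, X U * (U i₁ p * U i₂ p * star (U i₃ p * U i₄ p) +
        U i₁ q * U i₂ q * star (U i₃ q * U i₄ q) +
        (U i₁ p * U i₂ q + U i₁ q * U i₂ p) *
          star (U i₃ p * U i₄ q + U i₃ q * U i₄ p)) ∂unitaryHaar n := by
  have hmix := sum_congr (M := ℂ) rfl fun m (_ : m ∈ range 4) =>
    integral_mul_repeated_column_eq_integral_mix hpq hX i₁ i₂ i₃ i₄ (pow_mem I_mem_unitary m)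
  rw [sum_const, card_range, nsmul_eq_mul, Nat.cast_ofNat, ← integral_finsetSum] at hmix
  · rw [hmix]
    refine integral_congr_ae (.of_forall fun U => ?_)
    simp only [← sum_div, ← mul_sum, sum_range_four_polarization]
    ring
  · exact fun m _ => integrable_unitaryHaar (by fun_prop)

theorem integral_mul_repeated_column (hpq : p ≠ q) (hXc : Continuous X)
    (hX : ∀ U V : Matrix.unitaryGroup (Fin n) ℂ,
      (∀ i j, j ≠ p → j ≠ q → U i j = V i j) → X U = X V)
    (i₁ i₂ i₃ i₄ : Fin n) :
    ∫ U, X U * (U i₁ p * U i₂ p * star (U i₃ p * U i₄ p)) ∂unitaryHaar n =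
      ∫ U, X U * (U i₁ p * U i₂ q * star (U i₃ p * U i₄ q)) ∂unitaryHaar n +
        ∫ U, X U * (U i₁ p * U i₂ q * star (U i₃ q * U i₄ p)) ∂unitaryHaar n := by
  let F (j₁ j₂ j₃ j₄ : Fin n) (U : Matrix.unitaryGroup (Fin n) ℂ) : ℂ :=
    X U * (U i₁ j₁ * U i₂ j₂ * star (U i₃ j₃ * U i₄ j₄))
  have hF (j₁ j₂ j₃ j₄ : Fin n) : Continuous (F j₁ j₂ j₃ j₄) := by dsimp only [F]; fun_prop
  have hswap (j₁ j₂ j₃ j₄ : Fin n) :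
      ∫ U, F (swap p q j₁) (swap p q j₂) (swap p q j₃) (swap p q j₄) U ∂unitaryHaar n =
        ∫ U, F j₁ j₂ j₃ j₄ U ∂unitaryHaar n := by
    rw [← integral_unitaryHaar_mul_right _ (columnPerm (swap p q))]
    refine integral_congr_ae (.of_forall fun U => ?_)
    have hXU : X (U * columnPerm (swap p q)) = X U :=
      hX _ _ fun i j hp hq => by rw [mul_columnPerm_apply, swap_apply_of_ne_of_ne hp hq]
    simp only [F, mul_columnPerm_apply, hXU, swap_apply_self]
  have hexpand : 4 * ∫ U, F p p p p U ∂unitaryHaar n =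
      ∫ U, F p p p p U ∂unitaryHaar n + ∫ U, F q q q q U ∂unitaryHaar n +
        (∫ U, F p q p q U ∂unitaryHaar n + ∫ U, F q p q p U ∂unitaryHaar n) +
        (∫ U, F p q q p U ∂unitaryHaar n + ∫ U, F q p p q U ∂unitaryHaar n) := by
    rw [four_mul_integral_mul_repeated_column hpq hXc hX]
    iterate 5 rw [← integral_add (integrable_unitaryHaar (by fun_prop))
      (integrable_unitaryHaar (by fun_prop))]
    refine integral_congr_ae (.of_forall fun U => ?_)
    simp only [F, star_add]
    ring
  have hpp := hswap p p p p
  have hpqpq := hswap p q p q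
  have hpqqp := hswap p q q p
  simp only [swap_apply_left, swap_apply_right] at hpp hpqpq hpqqp
  linear_combination (1 / 2 : ℂ) * (hexpand + hpp + hpqpq + hpqqp)

end RepeatedColumns

section Moments

variable {κ : Type*} {n : ℕ} {r : κ → Fin n} {S : Finset κ} {a b : κ → Fin n} {x y i j : κ}

variable (r S a b) in
/-- The mixed moment of the entries of a Haar unitary matrix in the positions `(r i, a i)` and of
the conjugates of the entries in the positions `(r i, b i)`, where `i` ranges over `S`. -/
noncomputable def moment : ℂ :=
  ∫ U, (∏ i ∈ S, U (r i) (a i)) * star (∏ i ∈ S, U (r i) (b i)) ∂unitaryHaar n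

theorem moment_empty : moment r ∅ a b = 1 := by
  simp [moment]

theorem moment_congr {a' b' : κ → Fin n} (ha : ∀ i ∈ S, a i = a' i) (hb : ∀ i ∈ S, b i = b' i) :
    moment r S a b = moment r S a' b' := by
  refine integral_congr_ae (.of_forall fun U => ?_)
  simp only [prod_congr rfl fun i hi => congrArg (U (r i)) (ha i hi),
    prod_congr rfl fun i hi => congrArg (U (r i)) (hb i hi)]

theorem moment_perm_comp (τ : Perm (Fin n)) :
    moment r S (τ ∘ a) (τ ∘ b) = moment r S a b := by
  rw [moment, moment, eq_comm, ← integral_unitaryHaar_mul_right _ (columnPerm τ)]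
  simp only [mul_columnPerm_apply, Function.comp_apply]

theorem sum_mul_star_apply (U : Matrix.unitaryGroup (Fin n) ℂ) (s t : Fin n) :
    ∑ c, U s c * star (U t c) = if s = t then 1 else 0 := by
  simpa [Matrix.mul_apply, Matrix.one_apply] using
    congrFun (congrFun (Matrix.mem_unitaryGroup_iff.1 U.2) s) t

variable [DecidableEq κ]

theorem prod_apply_update {β M : Type*} [CommMonoid M] (hx : x ∈ S) (f : κ → β → M) (g : κ → β)
    (c : β) :
    ∏ i ∈ S, f i (Function.update g x c i) = f x c * ∏ i ∈ S.erase x, f i (g i) := by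
  rw [← mul_prod_erase S _ hx, Function.update_self]
  congr 1
  exact prod_congr rfl fun i hi => by rw [Function.update_of_ne (ne_of_mem_erase hi)]

theorem sum_moment_update_update (hr : Function.Injective r) (hx : x ∈ S) (hi : i ∈ S) :
    ∑ c, moment r S (Function.update a x c) (Function.update b i c) =
      if i = x then moment r (S.erase x) a b else 0 := by
  simp only [moment]
  rw [← integral_finsetSum _ fun c _ => integrable_unitaryHaar (by fun_prop)]
  have hsum (U : Matrix.unitaryGroup (Fin n) ℂ) :
      ∑ c, (∏ k ∈ S, U (r k) (Function.update a x c k)) *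
          star (∏ k ∈ S, U (r k) (Function.update b i c k)) =
        if i = x then (∏ k ∈ S.erase x, U (r k) (a k)) * star (∏ k ∈ S.erase x, U (r k) (b k))
        else 0 := by
    calc
      _ = (∏ k ∈ S.erase x, U (r k) (a k)) * star (∏ k ∈ S.erase i, U (r k) (b k)) *
          ∑ c, U (r x) c * star (U (r i) c) := by
        rw [mul_sum]
        refine sum_congr rfl fun c _ => ?_
        rw [prod_apply_update hx fun k => U (r k), prod_apply_update hi fun k => U (r k), star_mul']
        ring
      _ = _ := by
        rw [sum_mul_star_apply]
        rcases eq_or_ne i x with rfl | hix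
        · simp
        · rw [if_neg (hr.ne hix.symm), if_neg hix, mul_zero]
  simp only [hsum]
  split_ifs <;> simp

theorem moment_eq_integral_cofactor_mul {a' b' : κ → Fin n} (hx : x ∈ S) (hy : y ∈ S.erase x)
    (hi : i ∈ S) (hj : j ∈ S.erase i) (ha : ∀ k ∈ (S.erase x).erase y, a' k = a k)
    (hb : ∀ k ∈ (S.erase i).erase j, b' k = b k) :
    moment r S a' b' =
      ∫ U, (∏ k ∈ (S.erase x).erase y, U (r k) (a k)) *
          star (∏ k ∈ (S.erase i).erase j, U (r k) (b k)) *
        (U (r y) (a' y) * U (r x) (a' x) * star (U (r j) (b' j) * U (r i) (b' i)))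
        ∂unitaryHaar n := by
  refine integral_congr_ae (.of_forall fun U => ?_)
  dsimp only
  rw [← mul_prod_erase S _ hx, ← mul_prod_erase _ _ hy, ← mul_prod_erase S _ hi,
    ← mul_prod_erase _ _ hj, prod_congr rfl fun k hk => congrArg (U (r k)) (ha k hk),
    prod_congr rfl fun k hk => congrArg (U (r k)) (hb k hk)]
  simp only [star_mul']
  ring

variable [Fintype κ] {π : Perm κ}

theorem moment_update_update_of_notMem_image (ha : Function.Injective a) (hπ : π.support ⊆ S)
    (hx : x ∈ S) {c : Fin n} (hc : c ∉ S.image a) :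
    moment r S (Function.update a x c) (Function.update (a ∘ π) (π.symm x) c) =
      moment r S a (a ∘ π) := by
  have hupdate {k : κ} (hk : k ∈ S) : Function.update a x c k = swap (a x) c (a k) := by
    rcases eq_or_ne k x with rfl | hkx
    · rw [Function.update_self, swap_apply_left]
    · rw [Function.update_of_ne hkx, swap_apply_of_ne_of_ne (ha.ne hkx)
        (ne_of_mem_of_not_mem (mem_image_of_mem a hk) hc)]
  rw [← Function.update_comp_equiv, ← moment_perm_comp (a := a) (swap (a x) c)]
  exact moment_congr (fun k => hupdate)
    fun k hk => hupdate ((apply_mem_iff_of_support_subset hπ k).2 hk)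

theorem moment_update_update_apply_eq_add (ha : Function.Injective a) (hπ : π.support ⊆ S)
    (hx : x ∈ S) (hy : y ∈ S.erase x) :
    moment r S (Function.update a x (a y)) (Function.update (a ∘ π) (π.symm x) (a y)) =
      moment r S a (a ∘ π) + moment r S a (a ∘ (swap x y * π : Perm κ)) := by
  have hyx : y ≠ x := ne_of_mem_erase hy
  have hsymm {z : κ} (hz : z ∈ S) : π.symm z ∈ S := by
    rwa [← apply_mem_iff_of_support_subset hπ, apply_symm_apply]
  have hj : π.symm y ∈ S.erase (π.symm x) :=
    mem_erase.2 ⟨π.symm.injective.ne hyx, hsymm (mem_of_mem_erase hy)⟩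
  have hcofactor {a' b' : κ → Fin n} := moment_eq_integral_cofactor_mul (r := r) (a := a)
    (b := a ∘ π) (a' := a') (b' := b') hx hy (hsymm hx) hj
  have hne {k : κ} (hk : k ∈ (S.erase x).erase y) : k ≠ y ∧ k ≠ x :=
    ⟨ne_of_mem_erase hk, ne_of_mem_erase (mem_of_mem_erase hk)⟩
  have hneπ {k : κ} (hk : k ∈ (S.erase (π.symm x)).erase (π.symm y)) : π k ≠ y ∧ π k ≠ x :=
    ⟨π.eq_symm_apply.not.1 (ne_of_mem_erase hk),
      π.eq_symm_apply.not.1 (ne_of_mem_erase (mem_of_mem_erase hk))⟩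
  have hmerge := integral_mul_repeated_column (ha.ne hyx)
    (X := fun U => (∏ k ∈ (S.erase x).erase y, U (r k) (a k)) *
      star (∏ k ∈ (S.erase (π.symm x)).erase (π.symm y), U (r k) ((a ∘ π) k)))
    (by fun_prop) (fun U V hUV => ?_) (r y) (r x) (r (π.symm y)) (r (π.symm x))
  · rw [hcofactor (fun k hk => Function.update_of_ne (hne hk).2 _ _)
        fun k hk => Function.update_of_ne (ne_of_mem_erase (mem_of_mem_erase hk)) _ _,
      hcofactor (fun _ _ => rfl) fun _ _ => rfl,
      hcofactor (fun _ _ => rfl) fun k hk => by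
        simp [swap_apply_of_ne_of_ne (hneπ hk).2 (hneπ hk).1]]
    simpa [hyx] using hmerge
  · refine congrArg₂ (· * star ·) (prod_congr rfl fun k hk => ?_) (prod_congr rfl fun k hk => ?_)
    · exact hUV _ _ (ha.ne (hne hk).1) (ha.ne (hne hk).2)
    · exact hUV _ _ (ha.ne (hneπ hk).1) (ha.ne (hneπ hk).2)

theorem natCast_mul_moment_add_sum_moment_swap_mul (hr : Function.Injective r)
    (ha : Function.Injective a) (hπ : π.support ⊆ S) (hx : x ∈ S) :
    n * moment r S a (a ∘ π) + ∑ y ∈ S.erase x, moment r S a (a ∘ (swap x y * π : Perm κ)) =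
      if π x = x then moment r (S.erase x) a (a ∘ π) else 0 := by
  have hi : π.symm x ∈ S := by
    rwa [← apply_mem_iff_of_support_subset hπ, apply_symm_apply]
  have hfix : π.symm x = x ↔ π x = x := by rw [Equiv.symm_apply_eq, eq_comm]
  have hself : moment r S (Function.update a x (a x)) (Function.update (a ∘ π) (π.symm x) (a x)) =
      moment r S a (a ∘ π) := by
    rw [Function.update_eq_self, ← Function.update_comp_equiv, Function.update_eq_self]
  have hcard : (#(S.image a)ᶜ : ℂ) + #S = n := by
    rw [← card_image_of_injective S ha, ← Nat.cast_add, card_compl_add_card, Fintype.card_fin]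
  have hcol := sum_moment_update_update (a := a) (b := a ∘ π) hr hx hi
  rw [← sum_compl_add_sum (S.image a), sum_image ha.injOn, ← add_sum_erase S _ hx, hself,
    sum_congr rfl fun c hc => moment_update_update_of_notMem_image ha hπ hx (mem_compl.1 hc),
    sum_congr rfl fun y hy => moment_update_update_apply_eq_add ha hπ hx hy, sum_add_distrib,
    sum_const, sum_const, card_erase_of_mem hx, nsmul_eq_mul, nsmul_eq_mul,
    Nat.cast_pred (card_pos.2 ⟨x, hx⟩)] at hcol
  simp only [← hfix, ← hcol, ← hcard]
  ring

end Moments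

section Weingarten

variable {κ A : Type*} [Fintype κ] [DecidableEq κ] [Ring A] [Algebra ℂ A] (ρ : Perm κ →* A)
  {n : ℕ} {r : κ → Fin n} {S : Finset κ} {x : κ}

/-- The image under a representation `ρ` of the unitary Weingarten function of the symmetric group
of a set `S`, as an element of the group algebra, computed in the rows and columns `r i`, `i ∈ S`,
of a Haar unitary matrix. -/
noncomputable def weingartenOn (r : κ → Fin n) (S : Finset κ) : A :=
  ∑ π : Perm κ with π.support ⊆ S, moment r S r (r ∘ π) • ρ π

theorem weingartenOn_empty : weingartenOn ρ r ∅ = 1 := by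
  simp [weingartenOn, filter_eq', moment_empty]

theorem jucysMurphy_mul_weingartenOn_insert (r : κ → Fin n) (x : κ) (S : Finset κ) :
    jucysMurphy ρ x S * weingartenOn ρ r (insert x S) =
      ∑ π : Perm κ with π.support ⊆ insert x S,
        (∑ y ∈ S, moment r (insert x S) r (r ∘ (swap x y * π : Perm κ))) • ρ π := by
  simp only [jucysMurphy, weingartenOn, sum_mul_sum, sum_smul, mul_smul_comm, ← map_mul]
  refine Eq.trans (sum_congr rfl fun y hy => ?_) sum_comm
  have hswap : (swap x y).support ⊆ insert x S :=
    support_swap_subset (mem_insert_self x S) (mem_insert_of_mem hy)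
  exact sum_equiv (Equiv.mulLeft (swap x y)) (by simp [support_mul_subset_iff_right hswap])
    (by simp)

theorem natCast_add_jucysMurphy_mul_weingartenOn_insert (hr : Function.Injective r) (hx : x ∉ S) :
    (n + jucysMurphy ρ x S) * weingartenOn ρ r (insert x S) = weingartenOn ρ r S := by
  rw [add_mul, jucysMurphy_mul_weingartenOn_insert, weingartenOn, weingartenOn, mul_sum,
    ← sum_add_distrib, filter_congr fun π _ => support_subset_iff_support_subset_insert hx,
    ← filter_filter, sum_filter (fun π : Perm κ => π x = x)]
  refine sum_congr rfl fun π hπ => ?_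
  have h := natCast_mul_moment_add_sum_moment_swap_mul hr hr ((mem_filter_univ π).1 hπ)
    (mem_insert_self x S)
  rw [erase_insert hx] at h
  rw [← nsmul_eq_mul, ← Nat.cast_smul_eq_nsmul ℂ, smul_smul, ← add_smul, h, ite_smul, zero_smul]

theorem weingartenOn_eq_descensionOn_mul [IsDedekindFiniteMonoid A] (hr : Function.Injective r)
    {r' : κ → Fin (n + 1)} (hr' : Function.Injective r') (hS : #S ≤ n) :
    weingartenOn ρ r S = descensionOn ρ ℂ n S * weingartenOn ρ r' S := by
  induction S using Finset.induction_on with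
  | empty => rw [descensionOn_empty, weingartenOn_empty, weingartenOn_empty, one_mul]
  | insert x S hx ih =>
    rw [card_insert_of_notMem hx] at hS
    have hS' : #S ≤ n := Nat.le_of_succ_le hS
    refine (descensionOn_insert_mul_eq ρ hx hS (isUnit_descensionOn ρ hS') (.one_right _) ?_ ?_
      (ih hS').symm).symm
    · rw [one_mul, natCast_add_jucysMurphy_mul_weingartenOn_insert ρ hr hx]
    · rw [one_mul, ← natCast_add_jucysMurphy_mul_weingartenOn_insert ρ hr' hx, Nat.cast_add_one]

end Weingarten

section GroupAlgebra

variable {R G : Type*} [Semiring R] [Monoid G] [Fintype G]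

/-- The element of the monoid algebra whose coefficients are the values of the function `f`. It
turns the convolution of functions on a symmetric group into the product of the monoid algebra. -/
noncomputable def toGroupAlgebra (f : G → R) : MonoidAlgebra R G :=
  ∑ g, f g • MonoidAlgebra.of R G g

theorem coeff_toGroupAlgebra (f : G → R) (g : G) : (toGroupAlgebra f).coeff g = f g := by
  classical simp [toGroupAlgebra, MonoidAlgebra.coeff_sum, Finsupp.single_apply]

theorem toGroupAlgebra_injective : Function.Injective (toGroupAlgebra (R := R) (G := G)) :=
  fun f₁ f₂ h => funext fun g => by rw [← coeff_toGroupAlgebra f₁, h, coeff_toGroupAlgebra]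

end GroupAlgebra

section SymmetricGroup

variable {k : ℕ}

theorem toGroupAlgebra_diracId : toGroupAlgebra (diracId k) = 1 := by
  simp [toGroupAlgebra, diracId, MonoidAlgebra.one_def]

theorem toGroupAlgebra_conv (f g : Perm (Fin k) → ℂ) :
    toGroupAlgebra (conv f g) = toGroupAlgebra f * toGroupAlgebra g := by
  simp only [toGroupAlgebra, conv, sum_mul_sum, sum_smul, smul_mul_smul_comm, ← map_mul]
  rw [sum_comm]
  exact sum_congr rfl fun σ _ => sum_equiv (Equiv.mulLeft σ⁻¹) (by simp) (by simp)

theorem sum_superset_apply_card {ι M : Type*} [Fintype ι] [DecidableEq ι] [AddCommMonoid M]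
    (w : ℕ → M) (s : Finset ι) :
    ∑ T : Finset ι with s ⊆ T, w #T =
      ∑ t ∈ range (#sᶜ + 1), (#sᶜ).choose t • w (Fintype.card ι - t) := by
  rw [← sum_powerset_apply_card fun t => w (Fintype.card ι - t)]
  exact sum_bij' (fun T _ => Tᶜ) (fun T _ => Tᶜ) (by simp) (by simp [subset_compl_comm])
    (by simp) (by simp) (by simp [card_compl, Nat.sub_sub_self, card_le_univ])

theorem fixCount_eq_card_compl_support (σ : Perm (Fin k)) : fixCount σ = #σ.supportᶜ := by
  simp [fixCount, compl_eq_univ_sdiff, Perm.support, filter_not]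

theorem weightedSymmetrizer_univ {K A : Type*} [CommRing K] [Ring A] [Algebra K A]
    (ρ : Perm (Fin k) →* A) (w : ℕ → K) :
    weightedSymmetrizer ρ w univ =
      ∑ σ, (∑ t ∈ range (fixCount σ + 1), (fixCount σ).choose t • w (k - t)) • ρ σ := by
  simp only [weightedSymmetrizer, symmetrizer, powerset_univ, smul_sum, sum_filter]
  rw [sum_comm]
  refine sum_congr rfl fun σ _ => ?_
  have h := sum_superset_apply_card w σ.support
  rw [Fintype.card_fin, ← fixCount_eq_card_compl_support, sum_filter] at h
  rw [← h, sum_smul]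
  simp only [ite_smul, zero_smul, smul_ite, smul_zero]

theorem toGroupAlgebra_ascension (n : ℕ) :
    toGroupAlgebra (ascension k n) = ascensionOn (MonoidAlgebra.of ℂ _) ℂ n univ := by
  simp only [toGroupAlgebra, ascension, ascensionOn, weightedSymmetrizer_univ, nsmul_eq_mul]
  simp only [mul_assoc, mul_left_comm]

theorem toGroupAlgebra_descension (n : ℕ) :
    toGroupAlgebra (descension k n) = descensionOn (MonoidAlgebra.of ℂ _) ℂ n univ := by
  simp only [toGroupAlgebra, descension, descensionOn, weightedSymmetrizer_univ, nsmul_eq_mul,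
    signTwist_apply]
  refine sum_congr rfl fun σ _ => ?_
  rw [mul_comm, mul_smul, Units.smul_def, Int.cast_smul_eq_zsmul]

theorem toGroupAlgebra_weingarten {n : ℕ} (h : k ≤ n) :
    toGroupAlgebra (weingarten k n h) =
      weingartenOn (MonoidAlgebra.of ℂ _) (Fin.castLE h) univ := by
  simp only [toGroupAlgebra, weingartenOn, subset_univ, filter_true]
  rfl

end SymmetricGroup

end WgCalc

theorem mainTheorem5 (k n : ℕ) (hk : 1 ≤ k) (hkn : k ≤ n) :
    WgCalc.conv (WgCalc.ascension k (n + 1)) (WgCalc.descension k n) = WgCalc.diracId k ∧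
      WgCalc.weingarten k n hkn =
        WgCalc.conv (WgCalc.descension k n)
          (WgCalc.weingarten k (n + 1) (hkn.trans (Nat.le_succ n))) := by
  have hcard : (Finset.univ : Finset (Fin k)).card ≤ n := by simpa using hkn
  constructor <;> apply WgCalc.toGroupAlgebra_injective
  · rw [WgCalc.toGroupAlgebra_conv, WgCalc.toGroupAlgebra_ascension,
      WgCalc.toGroupAlgebra_descension, WgCalc.toGroupAlgebra_diracId, mul_eq_one_comm]
    exact WgCalc.descensionOn_mul_ascensionOn _ hcard
  · rw [WgCalc.toGroupAlgebra_conv, WgCalc.toGroupAlgebra_descension,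
      WgCalc.toGroupAlgebra_weingarten, WgCalc.toGroupAlgebra_weingarten]
    exact WgCalc.weingartenOn_eq_descensionOn_mul _ (Fin.castLE_injective _)
      (Fin.castLE_injective _) hcard
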